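/- Words are finite sequences of letters from a totally ordered alphabet and are compared lexicographically. A \emph{Lyndon word} is a non-empty word $w$ such that $w<vu$ for every factorization $w=uv$ into non-empty words $u,v$ (in particular, every single letter is a Lyndon word). A \emph{factor} of a finite or infinite word is a finite word occurring contiguously in it. An infinite word $s=s[0]s[1]s[2]\cdots$ over two letters $x<y$ is \emph{Sturmian} if there are an irrational $\theta\in(0,1)$ and a real $\rho$ such that either, for all $n\ge 0$, $s[n]=x$ when $\lfloor (n+1)\theta+\rho\rfloor-\lfloor n\theta+\rho\rfloor=0$ and $s[n]=y$ otherwise, or the same holds with $\lceil\cdot\rceil$ in place of $\lfloor\cdot\rfloor$. A \emph{Christoffel word} is a Lyndon word that is a factor of some infinite Sturmian word over two letters $x<y$ of the alphabet. Saari's conjecture says: if $w$ is a Lyndon word of length $n\neq 6$ that has the least number of distinct Lyndon factors among all Lyndon words of length $n$, then $w$ is a Christoffel word. Theorem. Let $\Sigma$ be any totally ordered alphabet containing two letters $a<b$. The word $$aabaababaabaabababaabaababab$$ is a Lyndon word of length $28$ with exactly $10$ distinct Lyndon factors; $10$ is the minimum number of distinct Lyndon factors over all Lyndon words of length $28$ over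 $\Sigma$; and this word is not a Christoffel word. Consequently Saari's conjecture is false over $\Sigma$. -/

import Mathlib

/-- A finite word over a totally ordered alphabet is a Lyndon word if it is non-empty and
lexicographically strictly smaller than each of its nontrivial cyclic shifts
(one-letter words are Lyndon, and Lyndon words are automatically primitive).
The order on `List α` is the lexicographic one. -/
def IsLyndon {α : Type*} [LinearOrder α] (w : List α) : Prop :=
  w ≠ [] ∧ ∀ u v : List α, u ≠ [] → v ≠ [] → w = u ++ v → w < v ++ u

/-- The set of distinct Lyndon factors of `w`; a factor is a contiguous subword. -/
def lyndonFactors {α : Type*} [LinearOrder α] (w : List α) : Set (List α) :=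
  {z | z <:+: w ∧ IsLyndon z}

/-- The number of distinct Lyndon factors of `w` (a finite number, since `w` has finitely many
factors). -/
noncomputable def numLyndonFactors {α : Type*} [LinearOrder α] (w : List α) : ℕ :=
  (lyndonFactors w).ncard

/-- The infinite word `s` is Sturmian over the two letters `x`, `y`: it is the lower or the upper
mechanical word of some irrational slope `θ ∈ (0,1)` and some real intercept `ρ`, where `x`
stands for the difference `0`. -/
def IsSturmian {α : Type*} (x y : α) (s : ℕ → α) : Prop :=
  ∃ θ ρ : ℝ, Irrational θ ∧ 0 < θ ∧ θ < 1 ∧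
    ((∀ n : ℕ, s n = if ⌊((n : ℝ) + 1) * θ + ρ⌋ - ⌊(n : ℝ) * θ + ρ⌋ = 0 then x else y) ∨
     (∀ n : ℕ, s n = if ⌈((n : ℝ) + 1) * θ + ρ⌉ - ⌈(n : ℝ) * θ + ρ⌉ = 0 then x else y))

/-- The finite word `w` occurs in the infinite word `s`. -/
def IsFactorOfInfinite {α : Type*} (w : List α) (s : ℕ → α) : Prop :=
  ∃ i : ℕ, w = (List.range w.length).map (fun j => s (i + j))

/-- A Christoffel word: a Lyndon factor of an infinite Sturmian word over two letters `x < y`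
of the alphabet. -/
def IsChristoffel {α : Type*} [LinearOrder α] (w : List α) : Prop :=
  IsLyndon w ∧ ∃ (x y : α) (s : ℕ → α), x < y ∧ IsSturmian x y s ∧ IsFactorOfInfinite w s

/-- Saari's conjecture for words over the alphabet `α`: every Lyndon word of length `n ≠ 6` that
has the least number of distinct Lyndon factors among all Lyndon words of length `n` is a
Christoffel word. -/
def SaariConjecture (α : Type*) [LinearOrder α] : Prop :=
  ∀ w : List α, IsLyndon w → w.length ≠ 6 →
    (∀ u : List α, IsLyndon u → u.length = w.length →
      numLyndonFactors w ≤ numLyndonFactors u) →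
    IsChristoffel w

/-- The word `aabaababaabaabababaabaababab`. -/
def saariWord {α : Type*} (a b : α) : List α :=
  [a, a, b, a, a, b, a, b, a, a, b, a, a, b, a, b, a, b, a, a, b, a, a, b, a, b, a, b]

/-! ### Lexicographic order and factorization of Lyndon words -/

section Lexicographic

variable {α : Type*} [LinearOrder α]

/-! The substance is the lower bound. A Lyndon word of length at least 2 is a product `u ++ v` of
Lyndon words with `u < v` (`IsLyndon.exists_factorization`). Hence the Lyndon factors of a word can
be listed by increasing length, letters first, each later one being a product of two distinct
earlier ones. With fewer than 10 factors allowed, this leaves finitely many lists to try. `search`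
enumerates them, discarding a product that has a Lyndon factor missing from the list, and any branch
whose Fibonacci-like growth (`reach`) cannot attain length 28. No list attains it. Only the order of
the letters matters, so they may be taken to be 0, ..., k - 1.

The word itself is checked by computation. It is not Christoffel because two of its factors of
length 5 contain one and three letters `b`, whereas a Sturmian word is balanced. -/

theorem List.append_lt_append_left_iff (p s t : List α) : p ++ s < p ++ t ↔ s < t := by
  induction p with
  | nil => rfl
  | cons a p ih => simpa [List.cons_lt_cons_iff] using ih

theorem List.le_append_self (s t : List α) : s ≤ s ++ t := by
  rw [← not_lt]
  intro h
  nth_rewrite 2 [← List.append_nil s] at h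
  rw [List.append_lt_append_left_iff] at h
  simp at h

/-- Unless `x` is a prefix of `y`, the two words differ at some position, and this decides the
comparison whatever is appended. -/
theorem List.prefix_or_append_lt_append {x y : List α} (h : x < y) :
    x <+: y ∨ ∀ p q, x ++ p < y ++ q := by
  induction x generalizing y with
  | nil => exact Or.inl List.nil_prefix
  | cons a x ih =>
    cases y with
    | nil => simp at h
    | cons b y =>
      rw [List.cons_lt_cons_iff] at h
      rcases h with h | ⟨rfl, h⟩
      · right
        intro p q
        simp [List.cons_lt_cons_iff, h]
      · rcases ih h with h | h
        · left
          simpa [List.cons_prefix_cons] using h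
        · right
          intro p q
          simpa [List.cons_lt_cons_iff] using h p q

/-- If `v < u ++ v` is decided at a differing letter, the shift `v ++ u` is too small. Otherwise `u
++ v = v ++ t`, and `v ++ t < v ++ u` gives `t < u` at equal lengths, so the shift `t ++ v` is too
small. -/
theorem IsLyndon.lt_right {u v : List α} (h : IsLyndon (u ++ v)) (hu : u ≠ []) (hv : v ≠ []) :
    u ++ v < v := by
  have hul : 0 < u.length := List.length_pos_of_ne_nil hu
  by_contra hlt
  have hne : v ≠ u ++ v := by
    intro e
    have := congrArg List.length e
    simp only [List.length_append] at this
    omega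
  have hrot := h.2 u v hu hv rfl
  rcases List.prefix_or_append_lt_append (lt_of_le_of_ne (not_lt.1 hlt) hne) with ⟨t, ht⟩ | h1
  · have hlen : t.length = u.length := by
      have := congrArg List.length ht
      simp only [List.length_append] at this
      omega
    have htu : t < u := by
      rw [← ht, List.append_lt_append_left_iff] at hrot
      exact hrot
    have ht0 : t ≠ [] := List.ne_nil_of_length_pos (by omega)
    have hrot' := h.2 v t hv ht0 ht.symm
    rcases List.prefix_or_append_lt_append htu with hp | h2
    · exact absurd (hp.eq_of_length hlen) htu.ne
    · exact lt_asymm hrot' (h2 v v)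
  · have := h1 u []
    rw [List.append_nil] at this
    exact lt_asymm hrot this

theorem isLyndon_iff_forall_suffix {w : List α} :
    IsLyndon w ↔ w ≠ [] ∧ ∀ v, v <:+ w → v ≠ [] → v ≠ w → w < v := by
  constructor
  · rintro h
    refine ⟨h.1, ?_⟩
    rintro v ⟨u, rfl⟩ hv hne
    exact h.lt_right (by rintro rfl; exact hne rfl) hv
  · rintro ⟨h0, h⟩
    refine ⟨h0, ?_⟩
    rintro u v hu hv rfl
    refine (h v (List.suffix_append u v) hv ?_).trans_le (List.le_append_self v u)
    intro e
    exact hu (List.self_eq_append_left.1 e)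

theorem isLyndon_singleton (a : α) : IsLyndon [a] := by
  rw [isLyndon_iff_forall_suffix]
  refine ⟨by simp, fun v hv h0 hne => ?_⟩
  rcases List.suffix_cons_iff.1 hv with h | h
  · exact absurd h hne
  · exact absurd (List.suffix_nil.1 h) h0

/-- Take for `v` the least proper non-empty suffix; it is Lyndon since its suffixes are suffixes of
`w`. A suffix `x < u` of `u` would have to be a prefix of `u`, and comparing `x` with `v` then
contradicts either the minimality of `v` or `w < v`. -/
theorem IsLyndon.exists_factorization {w : List α} (h : IsLyndon w) (h2 : 2 ≤ w.length) :
    ∃ u v, w = u ++ v ∧ IsLyndon u ∧ IsLyndon v ∧ u < v := by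
  have hsuf := (isLyndon_iff_forall_suffix.1 h).2
  have hw : ∃ x, x ∈ w.tails.toFinset.filter (fun v => v ≠ [] ∧ v ≠ w) := by
    obtain ⟨a, t, rfl⟩ := List.exists_cons_of_ne_nil h.1
    refine ⟨t, ?_⟩
    simp only [Finset.mem_filter, List.mem_toFinset, List.mem_tails]
    refine ⟨List.suffix_cons a t, ?_, ?_⟩
    · rintro rfl
      simp at h2
    · intro e
      simpa using congrArg List.length e
  obtain ⟨v, hv, hmin⟩ := Finset.exists_min_image _ (fun v : List α => v) hw
  simp only [Finset.mem_filter, List.mem_toFinset, List.mem_tails] at hv hmin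
  obtain ⟨⟨u, rfl⟩, hv0, hvw⟩ := hv
  have hu0 : u ≠ [] := by
    rintro rfl
    exact hvw rfl
  have hwv := hsuf v (List.suffix_append u v) hv0 hvw
  refine ⟨u, v, rfl, ?_, ?_, (List.le_append_self u v).trans_lt hwv⟩
  · rw [isLyndon_iff_forall_suffix]
    refine ⟨hu0, ?_⟩
    rintro x ⟨y, rfl⟩ hx0 hxu
    have hy0 : y ≠ [] := by
      rintro rfl
      exact hxu rfl
    have hyl : 0 < y.length := List.length_pos_of_ne_nil hy0
    have hxs : x ++ v <:+ y ++ x ++ v := ⟨y, by simp⟩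
    have hxne : x ++ v ≠ y ++ x ++ v := by
      intro e
      have := congrArg List.length e
      simp only [List.length_append] at this
      omega
    have hlt := hsuf (x ++ v) hxs (by simp [hx0]) hxne
    by_contra hcon
    rcases List.prefix_or_append_lt_append (lt_of_le_of_ne (not_lt.1 hcon) hxu) with ⟨t, ht⟩ | h1
    · have hvx : v < x ++ v := lt_of_le_of_ne (hmin _ ⟨hxs, by simp [hx0], hxne⟩) (by simp [hx0])
      have hxv : x ≠ v := by
        rintro rfl
        rw [← ht, List.append_assoc] at hwv
        exact (List.le_append_self x (t ++ x)).not_gt hwv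
      rcases lt_or_gt_of_ne hxv with h3 | h3
      · rcases List.prefix_or_append_lt_append h3 with ⟨s, rfl⟩ | h4
        · rw [List.append_lt_append_left_iff] at hvx
          refine (hmin s ⟨⟨y ++ x ++ x, by simp⟩, ?_, ?_⟩).not_gt hvx
          · rintro rfl
            simp at hxv
          · intro e
            have := congrArg List.length e
            simp only [List.length_append] at this
            omega
        · exact lt_asymm hvx (by simpa using h4 v [])
      · rcases List.prefix_or_append_lt_append h3 with ⟨s, rfl⟩ | h4
        · rw [← ht, List.append_assoc, List.append_assoc] at hwv
          exact (List.le_append_self v _).not_gt hwv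
        · have := h4 [] (t ++ v)
          rw [List.append_nil, ← List.append_assoc, ht] at this
          exact lt_asymm hwv this
    · exact lt_asymm hlt (h1 v v)
  · rw [isLyndon_iff_forall_suffix]
    refine ⟨hv0, fun x hx hx0 hxv => ?_⟩
    refine lt_of_le_of_ne (hmin x ⟨hx.trans (List.suffix_append u v), hx0, ?_⟩) hxv.symm
    rintro rfl
    have := hx.length_le
    have hul : 0 < u.length := List.length_pos_of_ne_nil hu0
    simp only [List.length_append] at this
    omega

end Lexicographic

/-! ### Invariance under order-preserving relabelling of letters -/

section Transport

variable {α β : Type*} [LinearOrder α] [LinearOrder β] {g : α → β} {s : Set α}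

theorem StrictMonoOn.list_map_lt_iff (hg : StrictMonoOn g s) {x y : List α}
    (hx : ∀ a ∈ x, a ∈ s) (hy : ∀ a ∈ y, a ∈ s) : x.map g < y.map g ↔ x < y := by
  induction x generalizing y with
  | nil => cases y <;> simp
  | cons a x ih =>
    cases y with
    | nil => simp
    | cons b y =>
      simp only [List.mem_cons, forall_eq_or_imp] at hx hy
      simp only [List.map_cons, List.cons_lt_cons_iff, hg.lt_iff_lt hx.1 hy.1,
        hg.injOn.eq_iff hx.1 hy.1, ih hx.2 hy.2]

theorem StrictMonoOn.list_map_injOn (hg : StrictMonoOn g s) :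
    Set.InjOn (List.map g) {x | ∀ a ∈ x, a ∈ s} := by
  intro x hx y hy h
  by_contra hne
  rcases lt_or_gt_of_ne hne with h1 | h1
  · exact ((hg.list_map_lt_iff hx hy).2 h1).ne h
  · exact ((hg.list_map_lt_iff hy hx).2 h1).ne h.symm

theorem StrictMonoOn.isLyndon_map_iff (hg : StrictMonoOn g s) {w : List α}
    (hw : ∀ a ∈ w, a ∈ s) : IsLyndon (w.map g) ↔ IsLyndon w := by
  simp only [isLyndon_iff_forall_suffix, ne_eq, List.map_eq_nil_iff, List.suffix_map_iff]
  refine and_congr_right fun _ => ?_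
  constructor
  · intro h v hv hv0 hne
    have hvs : ∀ a ∈ v, a ∈ s := fun a ha => hw a (hv.subset ha)
    exact (hg.list_map_lt_iff hw hvs).1
      (h _ ⟨v, hv, rfl⟩ (by simpa using hv0) fun e => hne (hg.list_map_injOn hvs hw e))
  · rintro h _ ⟨v, hv, rfl⟩ hv0 hne
    have hvs : ∀ a ∈ v, a ∈ s := fun a ha => hw a (hv.subset ha)
    exact (hg.list_map_lt_iff hw hvs).2
      (h v hv (by simpa using hv0) fun e => hne (by rw [e]))

theorem StrictMonoOn.numLyndonFactors_map (hg : StrictMonoOn g s) {w : List α}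
    (hw : ∀ a ∈ w, a ∈ s) : numLyndonFactors (w.map g) = numLyndonFactors w := by
  have himage : lyndonFactors (w.map g) = List.map g '' lyndonFactors w := by
    ext z
    simp only [lyndonFactors, Set.mem_ofPred_eq, Set.mem_image, List.infix_map_iff]
    constructor
    · rintro ⟨⟨v, hv, rfl⟩, hz⟩
      exact ⟨v, ⟨hv, (hg.isLyndon_map_iff fun a ha => hw a (hv.subset ha)).1 hz⟩, rfl⟩
    · rintro ⟨v, ⟨hv, hl⟩, rfl⟩
      exact ⟨⟨v, hv, rfl⟩, (hg.isLyndon_map_iff fun a ha => hw a (hv.subset ha)).2 hl⟩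
  rw [numLyndonFactors, numLyndonFactors, himage]
  have hsub : lyndonFactors w ⊆ {x | ∀ a ∈ x, a ∈ s} := fun v hv a ha => hw a (hv.1.subset ha)
  exact (hg.list_map_injOn.mono hsub).ncard_image

/-- Every word is isomorphic to a word whose letters are an initial segment of `ℕ`. -/
theorem List.exists_strictMonoOn_toFinset_map_eq_range (w : List α) :
    ∃ g : α → ℕ, StrictMonoOn g {a | a ∈ w} ∧ ∃ k, (w.map g).toFinset = Finset.range k := by
  let g : α → ℕ := fun x => (w.toFinset.filter (· < x)).card
  have hg : StrictMonoOn g {a | a ∈ w} := by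
    intro x hx y _ hxy
    refine Finset.card_lt_card (Finset.ssubset_iff_subset_ne.2 ⟨?_, ?_⟩)
    · exact Finset.monotone_filter_right _ fun a _ h => lt_trans h hxy
    · intro e
      have : x ∈ w.toFinset.filter (· < x) := by
        rw [e]
        simp [hxy, show x ∈ w from hx]
      simp at this
  refine ⟨g, hg, w.toFinset.card, ?_⟩
  have himage : (w.map g).toFinset = w.toFinset.image g := by
    ext
    simp
  rw [himage]
  refine Finset.eq_of_subset_of_card_le ?_ ?_
  · intro n hn
    obtain ⟨x, hx, rfl⟩ := Finset.mem_image.1 hn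
    rw [Finset.mem_range]
    refine Finset.card_lt_card (Finset.filter_ssubset.2 ⟨x, hx, lt_irrefl x⟩)
  · rw [Finset.card_range, Finset.card_image_of_injOn]
    intro x hx y hy h
    exact hg.injOn (by simpa using hx) (by simpa using hy) h

end Transport

/-! ### Exhaustive search over sets closed under Lyndon factors -/

section Search

/-- Strict lexicographic comparison of words over `ℕ`, in a form that evaluates quickly. -/
def lexLt : List ℕ → List ℕ → Bool
  | _, [] => false
  | [], _ :: _ => true
  | a :: x, b :: y => Nat.blt a b || (Nat.beq a b && lexLt x y)

theorem lexLt_iff (x y : List ℕ) : lexLt x y = true ↔ x < y := by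
  induction x generalizing y with
  | nil => cases y <;> simp [lexLt]
  | cons a x ih =>
    cases y with
    | nil => simp [lexLt]
    | cons b y => simp [lexLt, List.cons_lt_cons_iff, ih]

def lyndonTest (w : List ℕ) : Bool :=
  !w.isEmpty && w.tails.all fun v => v.isEmpty || w == v || lexLt w v

theorem lyndonTest_iff (w : List ℕ) : lyndonTest w = true ↔ IsLyndon w := by
  rw [isLyndon_iff_forall_suffix]
  simp only [lyndonTest, Bool.and_eq_true, Bool.not_eq_true', List.isEmpty_eq_false_iff,
    List.all_eq_true, List.mem_tails, Bool.or_eq_true, List.isEmpty_iff, beq_iff_eq, lexLt_iff]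
  refine and_congr_right fun _ => forall_congr' fun v => imp_congr_right fun _ => ?_
  constructor
  · rintro ((h | h) | h) h1 h2
    · exact absurd h h1
    · exact absurd h.symm h2
    · exact h
  · intro h
    by_cases h1 : v = []
    · simp [h1]
    · by_cases h2 : v = w
      · simp [h2]
      · exact Or.inr (h h1 h2)

def listFactors (w : List ℕ) : List (List ℕ) :=
  w.tails.flatMap List.inits

theorem mem_listFactors {w z : List ℕ} : z ∈ listFactors w ↔ z <:+: w := by
  simp only [listFactors, List.mem_flatMap, List.mem_tails, List.mem_inits,
    List.infix_iff_prefix_suffix]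
  exact exists_congr fun _ => and_comm

theorem lyndonFactors_eq (w : List ℕ) :
    lyndonFactors w = ((listFactors w).filter lyndonTest).toFinset := by
  ext z
  simp [lyndonFactors, mem_listFactors, lyndonTest_iff]

/-- The largest length reachable from words of lengths at most `A`, all but one of which have length
at most `B`, by `n` successive concatenations of two distinct words. -/
def reach : ℕ → ℕ → ℕ → ℕ
  | 0, A, _ => A
  | n + 1, A, B => reach n (A + B) A

theorem le_reach (n A B : ℕ) : A ≤ reach n A B := by
  induction n generalizing A B with
  | zero => exact le_rfl
  | succ n ih => exact (Nat.le_add_right A B).trans (ih (A + B) A)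

/-- All Lyndon factors of `z` other than `z` belong to `P`. -/
def factorsTest (P : List (List ℕ)) (z : List ℕ) : Bool :=
  (listFactors z).all fun y => y == z || P.contains y || !lyndonTest y

/-- Exhaustive search showing that no word of length `T` can be added to the Lyndon words in `P`,
of length at most `A`, within `n` concatenations that keep the set closed under Lyndon factors. -/
def search (T : ℕ) : ℕ → ℕ → List (List ℕ) → Bool
  | 0, A, _ => Nat.blt A T
  | n + 1, A, P => Nat.blt A T && P.all fun u => P.all fun v => !lexLt u v ||
      (Nat.blt (u ++ v).length A || Nat.blt T (u ++ v).length ||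
        Nat.blt (reach n (u ++ v).length A) T || P.contains (u ++ v) ||
        !factorsTest P (u ++ v) || search T n (u ++ v).length ((u ++ v) :: P))

/-- A set of Lyndon words that contains the Lyndon factors of its elements. -/
def LyndonClosed (S : Finset (List ℕ)) : Prop :=
  ∀ z ∈ S, IsLyndon z ∧ ∀ y, y <:+: z → IsLyndon y → y ∈ S

/-- `P` lists a subset of `S` that contains all its letters and is initial for the length. -/
structure IsInitialList (P : List (List ℕ)) (S : Finset (List ℕ)) : Prop where
  subset : ∀ x ∈ P, x ∈ S
  letters : ∀ x ∈ S, x.length = 1 → x ∈ P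
  length_le : ∀ x ∈ S, x ∉ P → ∀ y ∈ P, y.length ≤ x.length

/-- A shortest missing element is not a letter, and its two Lyndon factors are shorter, hence
already listed. -/
theorem IsInitialList.exists_cons {P : List (List ℕ)} {S : Finset (List ℕ)}
    (hP : IsInitialList P S) (hS : LyndonClosed S) {x : List ℕ} (hx : x ∈ S) (hxP : x ∉ P) :
    ∃ u ∈ P, ∃ v ∈ P, u < v ∧ u ++ v ∈ S ∧ u ++ v ∉ P ∧ IsInitialList ((u ++ v) :: P) S := by
  obtain ⟨z, hz, hmin⟩ := Finset.exists_min_image (S.filter (· ∉ P)) List.length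
    ⟨x, Finset.mem_filter.2 ⟨hx, hxP⟩⟩
  obtain ⟨hzS, hzP⟩ := Finset.mem_filter.1 hz
  have hmem : ∀ y ∈ S, y.length < z.length → y ∈ P := fun y hy hlt => by
    by_contra hyP
    exact absurd (hmin y (Finset.mem_filter.2 ⟨hy, hyP⟩)) (by omega)
  have hz0 := List.length_pos_of_ne_nil (hS z hzS).1.1
  have hz1 : z.length ≠ 1 := fun h => hzP (hP.letters z hzS h)
  obtain ⟨u, v, rfl, hu, hv, huv⟩ := (hS z hzS).1.exists_factorization (by omega)
  have hu0 := List.length_pos_of_ne_nil hu.1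
  have hv0 := List.length_pos_of_ne_nil hv.1
  have hlen := List.length_append (as := u) (bs := v)
  refine ⟨u, hmem u ((hS _ hzS).2 u (List.prefix_append u v).isInfix hu) (by omega),
    v, hmem v ((hS _ hzS).2 v (List.suffix_append u v).isInfix hv) (by omega), huv, hzS, hzP, ?_⟩
  refine ⟨?_, fun y hy h => List.mem_cons_of_mem _ (hP.letters y hy h), ?_⟩
  · intro y hy
    rcases List.mem_cons.1 hy with rfl | hy
    · exact hzS
    · exact hP.subset y hy
  · intro y hy hyP w hw
    rw [List.mem_cons, not_or] at hyP
    rcases List.mem_cons.1 hw with rfl | hw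
    · exact hmin y (Finset.mem_filter.2 ⟨hy, hyP.2⟩)
    · exact hP.length_le y hy hyP.2 w hw

theorem card_sdiff_cons_le {S : Finset (List ℕ)} {P : List (List ℕ)} {z : List ℕ} {n : ℕ}
    (hz : z ∈ S) (hzP : z ∉ P) (hn : (S \ P.toFinset).card ≤ n + 1) :
    (S \ (z :: P).toFinset).card ≤ n := by
  refine Nat.le_of_lt_succ (lt_of_lt_of_le (Finset.card_lt_card ?_) hn)
  refine (Finset.ssubset_iff_of_subset ?_).2 ⟨z, ?_, ?_⟩
  · intro y
    simp only [Finset.mem_sdiff, List.mem_toFinset, List.mem_cons, not_or]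
    tauto
  · simp [hz, hzP]
  · simp

theorem mem_of_card_sdiff_le_zero {S : Finset (List ℕ)} {P : List (List ℕ)}
    (hn : (S \ P.toFinset).card ≤ 0) {x : List ℕ} (hx : x ∈ S) : x ∈ P := by
  have h := Finset.card_eq_zero.1 (Nat.le_zero.1 hn)
  have := Finset.sdiff_eq_empty_iff_subset.1 h hx
  simpa using this

/-- Since `u < v`, at most one of the two words joined is the exceptional `h`, so the new length is
at most `A + B`; the new word then becomes the exception and `A` bounds the others. -/
theorem LyndonClosed.length_le_reach {S : Finset (List ℕ)} (hS : LyndonClosed S) (n : ℕ) :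
    ∀ (A B : ℕ) (P : List (List ℕ)), IsInitialList P S → (S \ P.toFinset).card ≤ n →
      (∃ h, (∀ x ∈ P, x.length ≤ A) ∧ ∀ x ∈ P, x ≠ h → x.length ≤ B) →
      ∀ x ∈ S, x.length ≤ reach n A B := by
  induction n with
  | zero =>
    rintro A B P - hn ⟨-, hA, -⟩ x hx
    exact hA x (mem_of_card_sdiff_le_zero hn hx)
  | succ n ih =>
    rintro A B P hP hn ⟨h, hA, hB⟩ x hx
    by_cases hxP : x ∈ P
    · exact (hA x hxP).trans (le_reach _ _ _)
    · obtain ⟨u, hu, v, hv, huv, hzS, hzP, hP'⟩ := hP.exists_cons hS hx hxP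
      have hlen : (u ++ v).length ≤ A + B := by
        rw [List.length_append]
        by_cases huh : u = h
        · exact Nat.add_le_add (hA u hu) (hB v hv (huh ▸ huv.ne'))
        · rw [add_comm]
          exact Nat.add_le_add (hA v hv) (hB u hu huh)
      refine ih (A + B) A _ hP' (card_sdiff_cons_le hzS hzP hn) ⟨u ++ v, ?_, ?_⟩ x hx
      · intro y hy
        rcases List.mem_cons.1 hy with rfl | hy
        · exact hlen
        · exact (hA y hy).trans (Nat.le_add_right A B)
      · intro y hy hne
        exact hA y ((List.mem_cons.1 hy).resolve_left hne)

/-- Soundness of the search: the next word of `S` is among the products tried, and no reason for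
skipping a product can apply to it unless `T` is out of reach. -/
theorem LyndonClosed.length_ne_of_search {S : Finset (List ℕ)} (hS : LyndonClosed S) {T : ℕ}
    (hT : ∀ x ∈ S, x.length ≤ T) (n : ℕ) :
    ∀ (A : ℕ) (P : List (List ℕ)), IsInitialList P S → (S \ P.toFinset).card ≤ n →
      (∀ x ∈ P, x.length ≤ A) → (∀ x ∈ S, x ∉ P → A ≤ x.length) → search T n A P = true → ∀ x ∈ S, x.length ≠ T := by
  induction n with
  | zero =>
    intro A P _ hn hA _ hs x hx
    rw [search, Nat.blt_eq] at hs
    exact ((hA x (mem_of_card_sdiff_le_zero hn hx)).trans_lt hs).ne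
  | succ n ih =>
    intro A P hP hn hA hA' hs x hx
    rw [search, Bool.and_eq_true, Nat.blt_eq] at hs
    by_cases hxP : x ∈ P
    · exact ((hA x hxP).trans_lt hs.1).ne
    · obtain ⟨u, hu, v, hv, huv, hzS, hzP, hP'⟩ := hP.exists_cons hS hx hxP
      have hlen : ∀ y ∈ (u ++ v) :: P, y.length ≤ (u ++ v).length := by
        intro y hy
        rcases List.mem_cons.1 hy with rfl | hy
        · exact le_rfl
        · exact hP.length_le _ hzS hzP y hy
      have hcard := card_sdiff_cons_le hzS hzP hn
      have hs' := List.all_eq_true.1 (List.all_eq_true.1 hs.2 u hu) v hv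
      simp only [Bool.or_eq_true, Bool.not_eq_true', Nat.blt_eq, List.contains_iff_mem] at hs'
      rcases hs' with h | ((((h | h) | h) | h) | h) | h
      · rw [(lexLt_iff u v).2 huv] at h
        exact absurd h (by decide)
      · exact absurd (hA' _ hzS hzP) (by omega)
      · exact absurd (hT _ hzS) (by omega)
      · have := hS.length_le_reach n (u ++ v).length A _ hP' hcard ⟨u ++ v, hlen, fun y hy hne =>
          hA y ((List.mem_cons.1 hy).resolve_left hne)⟩ x hx
        omega
      · exact absurd h hzP
      -- A Lyndon factor of the new word still missing from the list would be at least as long as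
      -- that word, hence equal to it.
      · refine absurd h (ne_of_eq_of_ne ?_ (by decide : true ≠ false))
        refine List.all_eq_true.2 fun y hy => ?_
        simp only [Bool.or_eq_true, beq_iff_eq, List.contains_iff_mem, Bool.not_eq_true']
        by_cases hl : IsLyndon y
        · refine Or.inl ((em (y = u ++ v)).imp_right fun hne => ?_)
          have hyS := (hS _ hzS).2 y (mem_listFactors.1 hy) hl
          by_contra hyP
          have hle := hP'.length_le y hyS (by simp [hne, hyP]) (u ++ v) (by simp)
          exact hne ((mem_listFactors.1 hy).eq_of_length_le hle)
        · refine Or.inr (Bool.eq_false_iff.2 fun h => hl ((lyndonTest_iff y).1 h))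
      · exact ih _ _ hP' hcard hlen (fun y hy hyP => hP'.length_le y hy hyP _ (by simp)) h x hx

end Search
-- At least ten Lyndon factors in length 28
section LowerBound

theorem ten_le_numLyndonFactors_of_toFinset_eq_range {w : List ℕ} {k : ℕ}
    (hk : w.toFinset = Finset.range k) (hw : IsLyndon w) (hlen : w.length = 28) :
    10 ≤ numLyndonFactors w := by
  set S : Finset (List ℕ) := ((listFactors w).filter lyndonTest).toFinset with hSdef
  have hmem : ∀ z, z ∈ S ↔ z <:+: w ∧ IsLyndon z := by
    intro z
    simp [hSdef, mem_listFactors, lyndonTest_iff]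
  have hcard : numLyndonFactors w = S.card := by
    rw [numLyndonFactors, lyndonFactors_eq, Set.ncard_coe_finset]
  have hS : LyndonClosed S := fun z hz =>
    ⟨((hmem z).1 hz).2, fun y hy hly => (hmem y).2 ⟨hy.trans ((hmem z).1 hz).1, hly⟩⟩
  have hletter : ∀ i, i ∈ w ↔ i < k := by
    intro i
    rw [← List.mem_toFinset, hk, Finset.mem_range]
  set P : List (List ℕ) := (List.range k).map fun i => [i] with hPdef
  have hPmem : ∀ x, x ∈ P ↔ ∃ i < k, [i] = x := by
    intro x
    simp [hPdef]
  have hPS : ∀ x ∈ P, x ∈ S := by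
    intro x hx
    obtain ⟨i, hi, rfl⟩ := (hPmem x).1 hx
    exact (hmem _).2 ⟨(List.singleton_infix_iff i w).2 ((hletter i).2 hi), isLyndon_singleton i⟩
  have hP1 : ∀ x ∈ P, x.length = 1 := by
    intro x hx
    obtain ⟨i, _, rfl⟩ := (hPmem x).1 hx
    rfl
  have hS1 : ∀ x ∈ S, 1 ≤ x.length := fun x hx => List.length_pos_of_ne_nil (hS x hx).1.1
  have hP : IsInitialList P S := by
    refine ⟨hPS, fun x hx h1 => ?_, fun x hx _ y hy => (hP1 y hy).trans_le (hS1 x hx)⟩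
    obtain ⟨i, rfl⟩ := List.length_eq_one_iff.1 h1
    have hiw := (List.singleton_infix_iff i w).1 ((hmem _).1 hx).1
    exact (hPmem _).2 ⟨i, (hletter i).1 hiw, rfl⟩
  have hPcard : P.toFinset.card = k := by
    rw [List.toFinset_card_of_nodup, hPdef, List.length_map, List.length_range]
    exact List.nodup_range.map fun i j h => by simpa using h
  have hsub : P.toFinset ⊆ S := fun x hx => hPS x (List.mem_toFinset.1 hx)
  have hkS : k ≤ S.card := hPcard ▸ Finset.card_le_card hsub
  rw [hcard]
  by_contra hlt
  have hk9 : k ≤ 9 := by omega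
  have hsdiff : (S \ P.toFinset).card ≤ 9 - k := by
    rw [Finset.card_sdiff_of_subset hsub, hPcard]
    omega
  -- The `j` letters are themselves Lyndon factors, so at most `9 - j` longer ones remain.
  have hsearch : ∀ j ≤ 9, search 28 (9 - j) 1 ((List.range j).map fun i => [i]) = true := by
    decide +kernel
  exact hS.length_ne_of_search
    (fun x hx => hlen ▸ ((hmem x).1 hx).1.length_le) (9 - k) 1 P hP hsdiff
    (fun x hx => (hP1 x hx).le) (fun x hx _ => hS1 x hx) (hsearch k hk9) w
    ((hmem w).2 ⟨List.infix_rfl, hw⟩) hlen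

theorem IsLyndon.ten_le_numLyndonFactors {α : Type*} [LinearOrder α] {u : List α}
    (hu : IsLyndon u) (hlen : u.length = 28) : 10 ≤ numLyndonFactors u := by
  obtain ⟨g, hg, k, hk⟩ := u.exists_strictMonoOn_toFinset_map_eq_range
  rw [← hg.numLyndonFactors_map fun _ => id]
  exact ten_le_numLyndonFactors_of_toFinset_eq_range hk
    ((hg.isLyndon_map_iff fun _ => id).2 hu) (by simpa using hlen)

end LowerBound

/-! ### Balance of Sturmian words -/

section Sturmian

/-- The counting function of the letter `y` in a Sturmian word stays close to a linear one. -/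
theorem IsSturmian.exists_counting {α : Type*} {x y : α} {s : ℕ → α} (h : IsSturmian x y s) :
    ∃ (θ : ℝ) (F : ℕ → ℤ),
      (∀ n, F (n + 1) = F n ∧ s n = x ∨ F (n + 1) = F n + 1 ∧ s n = y) ∧
      ∀ n m : ℕ, |(F (n + m) - F n : ℝ) - m * θ| < 1 := by
  obtain ⟨θ, ρ, -, h0, h1, h | h⟩ := h
  · refine ⟨θ, fun n => ⌊(n : ℝ) * θ + ρ⌋, fun n => ?_, fun n m => ?_⟩
    · have hs := h n
      have e : ((n + 1 : ℕ) : ℝ) * θ + ρ = (n : ℝ) * θ + ρ + θ := by push_cast; ring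
      have e' : ((n : ℝ) + 1) * θ + ρ = (n : ℝ) * θ + ρ + θ := by ring
      rw [e'] at hs
      simp only [e]
      have l1 := Int.floor_le ((n : ℝ) * θ + ρ)
      have l2 := Int.lt_floor_add_one ((n : ℝ) * θ + ρ)
      have l3 := Int.floor_le ((n : ℝ) * θ + ρ + θ)
      have l4 := Int.lt_floor_add_one ((n : ℝ) * θ + ρ + θ)
      generalize ⌊(n : ℝ) * θ + ρ + θ⌋ = p at *
      generalize ⌊(n : ℝ) * θ + ρ⌋ = q at *
      have h3 : q < p + 1 := by exact_mod_cast (by linarith : (q : ℝ) < p + 1)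
      have h4 : p < q + 2 := by exact_mod_cast (by linarith : (p : ℝ) < q + 2)
      obtain rfl | rfl : p = q ∨ p = q + 1 := by omega
      · exact Or.inl ⟨rfl, by simpa using hs⟩
      · exact Or.inr ⟨rfl, by simpa using hs⟩
    · have l1 := Int.floor_le ((n : ℝ) * θ + ρ)
      have l2 := Int.lt_floor_add_one ((n : ℝ) * θ + ρ)
      have l3 := Int.floor_le (((n + m : ℕ) : ℝ) * θ + ρ)
      have l4 := Int.lt_floor_add_one (((n + m : ℕ) : ℝ) * θ + ρ)
      have e : ((n + m : ℕ) : ℝ) * θ + ρ = (n : ℝ) * θ + ρ + m * θ := by push_cast; ring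
      rw [abs_lt]
      constructor <;> linarith
  · refine ⟨θ, fun n => ⌈(n : ℝ) * θ + ρ⌉, fun n => ?_, fun n m => ?_⟩
    · have hs := h n
      have e : ((n + 1 : ℕ) : ℝ) * θ + ρ = (n : ℝ) * θ + ρ + θ := by push_cast; ring
      have e' : ((n : ℝ) + 1) * θ + ρ = (n : ℝ) * θ + ρ + θ := by ring
      rw [e'] at hs
      simp only [e]
      have l1 := Int.le_ceil ((n : ℝ) * θ + ρ)
      have l2 := Int.ceil_lt_add_one ((n : ℝ) * θ + ρ)
      have l3 := Int.le_ceil ((n : ℝ) * θ + ρ + θ)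
      have l4 := Int.ceil_lt_add_one ((n : ℝ) * θ + ρ + θ)
      generalize ⌈(n : ℝ) * θ + ρ + θ⌉ = p at *
      generalize ⌈(n : ℝ) * θ + ρ⌉ = q at *
      have h3 : q < p + 1 := by exact_mod_cast (by linarith : (q : ℝ) < p + 1)
      have h4 : p < q + 2 := by exact_mod_cast (by linarith : (p : ℝ) < q + 2)
      obtain rfl | rfl : p = q ∨ p = q + 1 := by omega
      · exact Or.inl ⟨rfl, by simpa using hs⟩
      · exact Or.inr ⟨rfl, by simpa using hs⟩
    · have l1 := Int.le_ceil ((n : ℝ) * θ + ρ)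
      have l2 := Int.ceil_lt_add_one ((n : ℝ) * θ + ρ)
      have l3 := Int.le_ceil (((n + m : ℕ) : ℝ) * θ + ρ)
      have l4 := Int.ceil_lt_add_one (((n + m : ℕ) : ℝ) * θ + ρ)
      have e : ((n + m : ℕ) : ℝ) * θ + ρ = (n : ℝ) * θ + ρ + m * θ := by push_cast; ring
      rw [abs_lt]
      constructor <;> linarith

end Sturmian

/-! ### The counterexample -/

section SaariWord

theorem mem_pair_of_mem_saariWord {α : Type*} {a b : α} : ∀ c ∈ saariWord a b, c ∈ ({a, b} : Set α) := by
  intro c hc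
  simp only [saariWord, List.mem_cons, List.not_mem_nil, or_false] at hc
  simp only [Set.mem_insert_iff, Set.mem_singleton_iff]
  tauto

variable {α : Type*} [LinearOrder α] {a b : α}

theorem strictMonoOn_ite_pair (hab : a < b) :
    StrictMonoOn (fun x => if x = a then 0 else 1 : α → ℕ) {a, b} := by
  rintro x (rfl | rfl) y (rfl | rfl) h
  · exact absurd h (lt_irrefl _)
  · simp [hab.ne']
  · exact absurd h hab.not_gt
  · exact absurd h (lt_irrefl _)

theorem map_saariWord (hab : a < b) :
    (saariWord a b).map (fun x => if x = a then 0 else 1 : α → ℕ) = saariWord 0 1 := by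
  simp [saariWord, hab.ne']

theorem isLyndon_saariWord (hab : a < b) : IsLyndon (saariWord a b) := by
  rw [← (strictMonoOn_ite_pair hab).isLyndon_map_iff mem_pair_of_mem_saariWord,
    map_saariWord hab, ← lyndonTest_iff]
  decide +kernel

theorem numLyndonFactors_saariWord (hab : a < b) : numLyndonFactors (saariWord a b) = 10 := by
  rw [← (strictMonoOn_ite_pair hab).numLyndonFactors_map mem_pair_of_mem_saariWord,
    map_saariWord hab, numLyndonFactors, lyndonFactors_eq, Set.ncard_coe_finset]
  decide +kernel

/-- The factors `aabaa` and `babab` violate the balance of Sturmian words. -/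
theorem not_isChristoffel_saariWord (hab : a < b) : ¬ IsChristoffel (saariWord a b) := by
  rintro ⟨-, x, y, s, hxy, hs, i, hi⟩
  obtain ⟨θ, F, hF, hbal⟩ := hs.exists_counting
  have hget : ∀ j (hj : j < 28), (saariWord a b)[j]'hj = s (i + j) := by
    intro j hj
    have h := List.getElem_of_eq hi (i := j) hj
    rw [h]
    simp
  have hpair : ∀ n, s n = x ∨ s n = y := fun n => (hF n).imp And.right And.right
  have ha : a = s (i + 0) := hget 0 (by decide)
  have hb : b = s (i + 2) := hget 2 (by decide)
  -- Both letters occur in the word, and `x < y` excludes the swap.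
  obtain ⟨rfl, rfl⟩ : x = a ∧ y = b := by
    rcases hpair (i + 0) with h0 | h0 <;> rcases hpair (i + 2) with h2 | h2 <;>
      rw [← ha] at h0 <;> rw [← hb] at h2 <;> subst h0 <;> subst h2
    · exact absurd hab (lt_irrefl _)
    · exact ⟨rfl, rfl⟩
    · exact absurd hab hxy.not_gt
    · exact absurd hab (lt_irrefl _)
  have hstay : ∀ n, s n = x → F (n + 1) = F n := fun n hn =>
    (hF n).elim And.left fun h => absurd (hn.symm.trans h.2) hxy.ne
  have hjump : ∀ n, s n = y → F (n + 1) = F n + 1 := fun n hn =>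
    (hF n).elim (fun h => absurd (h.2.symm.trans hn) hxy.ne) And.left
  have p0 := hstay _ (hget 0 (by decide)).symm
  have p1 := hstay _ (hget 1 (by decide)).symm
  have p2 := hjump _ (hget 2 (by decide)).symm
  have p3 := hstay _ (hget 3 (by decide)).symm
  have p4 := hstay _ (hget 4 (by decide)).symm
  have q0 := hjump _ (hget 23 (by decide)).symm
  have q1 := hstay _ (hget 24 (by decide)).symm
  have q2 := hjump _ (hget 25 (by decide)).symm
  have q3 := hstay _ (hget 26 (by decide)).symm
  have q4 := hjump _ (hget 27 (by decide)).symm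
  simp only [add_assoc, Nat.reduceAdd, add_zero] at p0 p1 p2 p3 p4 q0 q1 q2 q3 q4
  -- One and three letters `b` in windows of length 5 force `5 * θ < 2` and `5 * θ > 2`.
  have hp : F (i + 5) = F i + 1 := by omega
  have hq : F (i + 23 + 5) = F (i + 23) + 3 := by
    simp only [add_assoc, Nat.reduceAdd]
    omega
  have h1 := hbal i 5
  have h2 := hbal (i + 23) 5
  rw [hp, abs_lt] at h1
  rw [hq, abs_lt] at h2
  push_cast at h1 h2
  linarith [h1.1, h2.2]

end SaariWord

theorem mainTheorem5 {α : Type*} [LinearOrder α] (a b : α) (hab : a < b) :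
    IsLyndon (saariWord a b) ∧
    (saariWord a b).length = 28 ∧
    numLyndonFactors (saariWord a b) = 10 ∧
    IsLeast {k : ℕ | ∃ u : List α, IsLyndon u ∧ u.length = 28 ∧ numLyndonFactors u = k} 10 ∧
    ¬ IsChristoffel (saariWord a b) ∧
    ¬ SaariConjecture α := by
  have hlyn := isLyndon_saariWord hab
  have hnum := numLyndonFactors_saariWord hab
  have hchr := not_isChristoffel_saariWord hab
  refine ⟨hlyn, rfl, hnum, ⟨⟨_, hlyn, rfl, hnum⟩, ?_⟩, hchr, fun hconj => hchr ?_⟩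
  · rintro _ ⟨u, hu, hlen, rfl⟩
    exact hu.ten_le_numLyndonFactors hlen
  · refine hconj _ hlyn (by simp [saariWord]) fun u hu hlen => ?_
    rw [hnum]
    exact hu.ten_le_numLyndonFactors hlen
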